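/- **Setting.** A data set is a tuple $\mathcal D=((x_i,y_i))_{i=1}^n$ with $x_i\in\mathbb R^d$ and labels $y_i\in[-1,1]$ (for example $y_i\in\{-1,1\}$). Two data sets of the same size are neighbours if they differ in the value of at most one entry. A randomized mechanism $M$ is $\epsilon$-differentially private if $\Pr(M(\mathcal D)\in S)\le e^{\epsilon}\Pr(M(\mathcal D')\in S)$ for all neighbours $\mathcal D,\mathcal D'$ and all measurable sets $S$ of outputs. Let $\ell(\hat y,y)=\log(1+e^{-y\hat y})$ and $\sigma(a)=e^a/(1+e^a)$. A function $g:\mathbb R^m\to\mathbb R$ is $1$-strongly convex if $g(\alpha w+(1-\alpha)u)\le\alpha g(w)+(1-\alpha)g(u)-\tfrac12\alpha(1-\alpha)\|w-u\|^2$ for all $w,u$ and $\alpha\in(0,1)$; no differentiability is assumed. To scale a vector to norm at most $r$ means to replace it by a nonnegative multiple of it of norm at most $r$, by a rule (a map, measurable in the case of the high-level model) that depends on that vector only and not on the rest of the data. **PLR** with budget $\epsilon>0$, parameter $\lambda>0$ and regularizer $g$, on $n\ge 1$ samples in $\mathbb R^m$. Put $\epsilon'=\epsilon-\log\bigl(1+\frac1{2n\lambda}+\frac1{16n^2\lambda^2}\bigr)$.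 If $\epsilon'>0$ let $\Delta=0$; otherwise let $\Delta=\frac1{4n(e^{\epsilon/4}-1)}-\lambda$ and replace $\epsilon'$ by $\epsilon/2$. Scale all $x_i$ to norm at most $1$, draw $b\in\mathbb R^m$ with density proportional to $e^{-\epsilon'\|b\|/2}$, and return $$\arg\min_w\ \frac1n\sum_i\ell(w^\top x_i,y_i)+\frac{b^\top w}{n}+\frac{\Delta\|w\|^2}{2}+\lambda g(w).$$ **PST-F** (privacy-preserving stacking with feature partitioning) with budget $\epsilon>0$, importances $q_k\ge0$, $\sum_{k=1}^Kq_k=1$, low-level parameters $\lambda_k>0$ and regularizers $g_k$, and high-level parameter $\lambda^h>0$ and regularizer $g^h$. Fix a partition of the positions $\{1,\dots,n\}$ into two nonempty sets, which splits $\mathcal D$ into $\mathcal D^l$ and $\mathcal D^h$, and a partition of the $d$ features into $K$ blocks; write $x_{(k)}$ for the vector of the features of $x$ in block $k$, and $n_l=|\mathcal D^l|$. Put $$\epsilon'=\epsilon-\sum_{k=1}^K\log\Bigl(1+\frac{q_k^2}{2n_l\lambda_k}+\frac{q_k^4}{16n_l^2\lambda_k^2}\Bigr).$$ If $\epsilon'>0$,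 let $\Delta_k=0$ and $\epsilon_k=\epsilon'$ for all $k$. Otherwise let $\epsilon_k=\epsilon/2$ and $\Delta_k=\frac{q_k^2}{4n_l(e^{\epsilon q_k/4}-1)}-\lambda_k$, with $\Delta_k=0$ if $q_k=0$. For each $k$, let $\bar x_{i,k}$ be $x_{i,(k)}$ scaled to norm at most $q_k$, draw $b_k$ independently with density proportional to $e^{-\epsilon_k\|b_k\|/2}$, and let $$w_k^l=\arg\min_w\ \frac1{n_l}\sum_{i\in\mathcal D^l}\ell(w^\top\bar x_{i,k},y_i)+\frac{b_k^\top w}{n_l}+\frac{\Delta_k\|w\|^2}{2}+\lambda_kg_k(w).$$ Then run PLR with budget $\epsilon$, parameter $\lambda^h$, regularizer $g^h$ and independent noise on the meta-data $\bigl([\sigma(x_{(1)}^\top w_1^l),\dots,\sigma(x_{(K)}^\top w_K^l)],y\bigr)$, $(x,y)\in\mathcal D^h$, to obtain $w^h\in\mathbb R^K$. The output is $(w_1^l,\dots,w_K^l,w^h)$. **Theorem.** If all low-level regularizers $g_k$ and the high-level regularizer $g^h$ are $1$-strongly convex, then PST-F is well defined (every $\arg\min$ exists and is unique, and the output is a random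 vector), and it is $\epsilon$-differentially private. -/

import Mathlib

open MeasureTheory

noncomputable section

namespace PrivateStacking

/-! ### Differential privacy -/

/-- Two data sets of the same size that differ in the value of at most one entry. -/
def Neighbours {ι X : Type*} (D D' : ι → X) : Prop :=
  ∃ i, ∀ j, j ≠ i → D j = D' j

/-- `M D` is the law of the output of the randomized mechanism on the data set `D`. -/
def IsDifferentiallyPrivate {ι X O : Type*} [MeasurableSpace O] (ε : ℝ)
    (M : (ι → X) → Measure O) : Prop :=
  ∀ D D' : ι → X, Neighbours D D' →
    ∀ S : Set O, MeasurableSet S → M D S ≤ ENNReal.ofReal (Real.exp ε) * M D' S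

/-! ### Objective perturbation for logistic regression -/

/-- A labelled sample. The labels `-1` and `1` are the class labels of logistic regression. -/
structure Sample (d : ℕ) where
  /-- the feature vector -/
  x : EuclideanSpace ℝ (Fin d)
  /-- the label -/
  y : ℝ
  abs_y_le_one : |y| ≤ 1

/-- The logistic loss of the prediction `yhat` for the label `y`. -/
def logLoss (yhat y : ℝ) : ℝ := Real.log (1 + Real.exp (-y * yhat))

/-- The perturbed regularized empirical risk on the samples `(x i, y i)`, `i ∈ I`:
`(1/n) ∑ ℓ(wᵀ xᵢ, yᵢ) + bᵀ w / n + Δ ‖w‖² / 2 + lam * g w`, where `n` is the number of samples. -/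
def objective {ι E : Type*} [NormedAddCommGroup E] [InnerProductSpace ℝ E]
    (I : Finset ι) (x : ι → E) (y : ι → ℝ) (b : E) (Δ lam : ℝ) (g : E → ℝ) (w : E) : ℝ :=
  1 / (I.card : ℝ) * ∑ i ∈ I, logLoss (inner ℝ w (x i)) (y i)
    + inner ℝ b w / (I.card : ℝ) + Δ * ‖w‖ ^ 2 / 2 + lam * g w

/-- `w` is a global minimizer of `f`. -/
def IsMinimizer {E : Type*} (f : E → ℝ) (w : E) : Prop := ∀ u, f w ≤ f u

/-- A global minimizer of `f` (an arbitrary point if there is none). -/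
def argmin {E : Type*} [Nonempty E] (f : E → ℝ) : E := Classical.epsilon (IsMinimizer f)

/-- The law with density proportional to `exp (-ε ‖b‖ / 2)`. -/
def noise (E : Type*) [NormedAddCommGroup E] [MeasureSpace E] (ε : ℝ) : Measure E :=
  (∫⁻ b : E, ENNReal.ofReal (Real.exp (-(ε * ‖b‖ / 2))))⁻¹ •
    (volume : Measure E).withDensity (fun b => ENNReal.ofReal (Real.exp (-(ε * ‖b‖ / 2))))

/-- `s` replaces every vector by a nonnegative multiple of it of norm at most `r`. -/
def IsScaling {E : Type*} [NormedAddCommGroup E] [NormedSpace ℝ E] (r : ℝ) (s : E → E) : Prop :=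
  ∀ x, (∃ c : ℝ, 0 ≤ c ∧ s x = c • x) ∧ ‖s x‖ ≤ r

/-! ### PLR: privacy-preserving logistic regression -/

/-- The modified budget before the case distinction, for `n` samples. -/
def plrEpsPrime (n : ℕ) (ε lam : ℝ) : ℝ :=
  ε - Real.log (1 + 1 / (2 * n * lam) + 1 / (16 * (n : ℝ) ^ 2 * lam ^ 2))

/-- The budget that calibrates the noise. -/
def plrEps (n : ℕ) (ε lam : ℝ) : ℝ :=
  if 0 < plrEpsPrime n ε lam then plrEpsPrime n ε lam else ε / 2

/-- The coefficient of the additional quadratic term. -/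
def plrDelta (n : ℕ) (ε lam : ℝ) : ℝ :=
  if 0 < plrEpsPrime n ε lam then 0 else (4 * n * (Real.exp (ε / 4) - 1))⁻¹ - lam

/-- The objective that PLR minimizes on the samples `(x i, y i)`, `i ∈ I`, for the noise `b`. -/
def plrObjective {ι E : Type*} [NormedAddCommGroup E] [InnerProductSpace ℝ E]
    (ε lam : ℝ) (g : E → ℝ) (s : E → E) (I : Finset ι) (x : ι → E) (y : ι → ℝ) (b : E) :
    E → ℝ :=
  objective I (fun i => s (x i)) y b (plrDelta I.card ε lam) lam g

/-! ### PST-F: privacy-preserving stacking with feature partitioning -/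

/-- The parameter vectors of a low-level model: one coordinate for each feature of block `k`. -/
abbrev Block {d K : ℕ} (block : Fin d → Fin K) (k : Fin K) : Type :=
  EuclideanSpace ℝ {j : Fin d // block j = k}

/-- The features of `x` that belong to block `k`. -/
def restrict {d K : ℕ} (block : Fin d → Fin K) (k : Fin K) (x : EuclideanSpace ℝ (Fin d)) :
    Block block k :=
  WithLp.toLp 2 (fun j => x j.1)

/-- The inputs and hyperparameters of PST-F other than the data set, for `n` samples with `d`
features in `K` blocks. -/
structure Config (n d K : ℕ) where
  /-- the privacy budget -/
  ε : ℝ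
  /-- the positions of the samples that train the low-level models; the other samples train the
  high-level model -/
  low : Finset (Fin n)
  /-- the block to which a feature belongs -/
  block : Fin d → Fin K
  /-- the importance of the blocks -/
  q : Fin K → ℝ
  /-- the regularization parameters of the low-level models -/
  lam : Fin K → ℝ
  /-- the regularizers of the low-level models -/
  g : ∀ k, Block block k → ℝ
  /-- the scaling applied to the low-level samples -/
  scale : ∀ k, Block block k → Block block k
  /-- the regularization parameter of the high-level model -/
  lamHigh : ℝ
  /-- the regularizer of the high-level model -/
  gHigh : EuclideanSpace ℝ (Fin K) → ℝ
  /-- the scaling applied by PLR to the meta-data -/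
  scaleHigh : EuclideanSpace ℝ (Fin K) → EuclideanSpace ℝ (Fin K)

namespace Config

variable {n d K : ℕ} (C : Config n d K)

/-- The modified budget before the case distinction. -/
def epsPrime : ℝ :=
  C.ε - ∑ k, Real.log (1 + C.q k ^ 2 / (2 * C.low.card * C.lam k)
    + C.q k ^ 4 / (16 * (C.low.card : ℝ) ^ 2 * C.lam k ^ 2))

/-- The budget that calibrates the noise of the low-level models. -/
def lowEps : ℝ := if 0 < C.epsPrime then C.epsPrime else C.ε / 2

/-- The coefficient of the additional quadratic term of low-level model `k`. In the second case the
quotient reads `0 / 0` for a block of importance zero; such a block gets no additional term. -/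
def lowDelta (k : Fin K) : ℝ :=
  if 0 < C.epsPrime ∨ C.q k = 0 then 0
  else C.q k ^ 2 / (4 * C.low.card * (Real.exp (C.ε * C.q k / 4) - 1)) - C.lam k

/-- The objective of low-level model `k` for the noise `b`. -/
def lowObjective (D : Fin n → Sample d) (k : Fin K) (b : Block C.block k) :
    Block C.block k → ℝ :=
  objective C.low (fun i => C.scale k (restrict C.block k (D i).x)) (fun i => (D i).y) b
    (C.lowDelta k) (C.lam k) (C.g k)

/-- The features of the meta-data: the predictions of the low-level models `w`. -/
def metaFeatures (w : ∀ k, Block C.block k) (x : EuclideanSpace ℝ (Fin d)) :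
    EuclideanSpace ℝ (Fin K) :=
  WithLp.toLp 2 (fun k => Real.sigmoid (inner ℝ (restrict C.block k x) (w k)))

/-- The objective of the high-level model: PLR with the full budget on the meta-data that are made
from the remaining samples by the low-level models `w`. -/
def highObjective (D : Fin n → Sample d) (w : ∀ k, Block C.block k)
    (b : EuclideanSpace ℝ (Fin K)) : EuclideanSpace ℝ (Fin K) → ℝ :=
  plrObjective C.ε C.lamHigh C.gHigh C.scaleHigh C.lowᶜ
    (fun i => C.metaFeatures w (D i).x) (fun i => (D i).y) b

/-- The low-level models for the noise vectors `b k`. -/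
def lowModels (D : Fin n → Sample d) (b : ∀ k, Block C.block k) : ∀ k, Block C.block k :=
  fun k => argmin (C.lowObjective D k (b k))

/-- The output of PST-F, low-level models and high-level model, as a function of the data set and
of all noise vectors. -/
def output (D : Fin n → Sample d) (b : (∀ k, Block C.block k) × EuclideanSpace ℝ (Fin K)) :
    (∀ k, Block C.block k) × EuclideanSpace ℝ (Fin K) :=
  (C.lowModels D b.1, argmin (C.highObjective D (C.lowModels D b.1) b.2))

/-- The joint law of the independent noise vectors of PST-F. -/
def noiseLaw : Measure ((∀ k, Block C.block k) × EuclideanSpace ℝ (Fin K)) :=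
  (Measure.pi fun k => noise (Block C.block k) C.lowEps).prod
    (noise (EuclideanSpace ℝ (Fin K)) (plrEps C.lowᶜ.card C.ε C.lamHigh))

/-- PST-F as a randomized mechanism: the law of its output on the data set `D`. -/
def pstf (D : Fin n → Sample d) : Measure ((∀ k, Block C.block k) × EuclideanSpace ℝ (Fin K)) :=
  C.noiseLaw.map (C.output D)

end Config

end PrivateStacking

end

open MeasureTheory

noncomputable section

namespace PrivateStacking

/-! ### Change of variables along a direction -/

/-- A surjective `κ`-Lipschitz map of the line shrinks the Lebesgue measure by at most `κ`. -/
lemma volume_le_smul_map_of_lipschitz {κ : NNReal} {τ : ℝ → ℝ} (hτ : LipschitzWith κ τ)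
    (hsurj : Function.Surjective τ) :
    (volume : Measure ℝ) ≤ (κ : ENNReal) • (volume : Measure ℝ).map τ := by
  refine Measure.le_iff.2 fun B hB => ?_
  rw [Measure.smul_apply, Measure.map_apply hτ.continuous.measurable hB, smul_eq_mul]
  have h := (hτ.lipschitzOnWith (s := τ ⁻¹' B)).hausdorffMeasure_image_le (d := 1) zero_le_one
  rw [Set.image_preimage_eq _ hsurj, hausdorffMeasure_real] at h
  simpa using h

lemma surjective_id_add_of_bounded {h : ℝ → ℝ} (hc : Continuous h) (hb : ∀ t, |h t| ≤ 1) :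
    Function.Surjective fun t => t + h t := by
  refine Continuous.surjective (by fun_prop) ?_ ?_
  · exact Filter.tendsto_atTop_mono (fun t => by dsimp; linarith [(abs_le.1 (hb t)).1])
      (Filter.tendsto_atTop_add_const_right _ (-1) Filter.tendsto_id)
  · exact Filter.tendsto_atBot_mono (fun t => by dsimp; linarith [(abs_le.1 (hb t)).2])
      (Filter.tendsto_atBot_add_const_right _ 1 Filter.tendsto_id)

section Shear

variable {E : Type*} [NormedAddCommGroup E] [InnerProductSpace ℝ E] [FiniteDimensional ℝ E]
  [MeasureSpace E] [BorelSpace E] [(volume : Measure E).IsAddHaarMeasure]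

/-- Averaging over the segments `b + t • v`, `t ∈ [r, r + s]`, does not change an integral. -/
lemma lintegral_lintegral_segment (f : E → ENNReal) (hf : Measurable f) (v : E) (r s : ℝ) :
    ∫⁻ b : E, ∫⁻ t in Set.Icc r (r + s), f (b + t • v) = ENNReal.ofReal s * ∫⁻ b, f b := by
  rw [lintegral_lintegral_swap (by fun_prop)]
  simp_rw [lintegral_add_right_eq_self f]
  simp [mul_comm]

lemma ennreal_le_of_forall_natCast_mul_le {a c : ENNReal}
    (h : ∀ R : ℕ, (R : ENNReal) * a ≤ (R + 2) * c) : a ≤ c := by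
  have h1 : ∀ R : ℕ, a ≤ (1 + 2 * ((R + 1 : ℕ) : ENNReal)⁻¹) * c := by
    intro R
    have h0 : ((R + 1 : ℕ) : ENNReal) ≠ 0 := by simp
    have ht : ((R + 1 : ℕ) : ENNReal) ≠ ⊤ := ENNReal.natCast_ne_top _
    calc a = ((R + 1 : ℕ) : ENNReal)⁻¹ * (((R + 1 : ℕ) : ENNReal) * a) := by
          rw [← mul_assoc, ENNReal.inv_mul_cancel h0 ht, one_mul]
      _ ≤ ((R + 1 : ℕ) : ENNReal)⁻¹ * ((((R + 1 : ℕ) : ENNReal) + 2) * c) :=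
          mul_le_mul_right (h (R + 1)) _
      _ = (1 + 2 * ((R + 1 : ℕ) : ENNReal)⁻¹) * c := by
          rw [← mul_assoc, mul_add, ENNReal.inv_mul_cancel h0 ht, mul_comm _ (2 : ENNReal)]
  rcases eq_or_ne c ⊤ with rfl | hc
  · exact le_top
  refine ge_of_tendsto' (x := Filter.atTop) (a := c) ?_ h1
  have h2 : Filter.Tendsto (fun R : ℕ => ((R + 1 : ℕ) : ENNReal)⁻¹) Filter.atTop (nhds 0) :=
    (Filter.tendsto_add_atTop_iff_nat 1).2 ENNReal.tendsto_inv_nat_nhds_zero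
  have h3 := ENNReal.Tendsto.mul_const (b := c)
    ((ENNReal.Tendsto.const_mul (a := 2) h2 (Or.inr (by simp))).const_add 1) (Or.inr hc)
  simpa using h3

/-- If `b ↦ b + h b • v` has Lipschitz constant `κ` along the direction `v`, then it shrinks
volumes by at most `κ`. -/
lemma lintegral_le_lintegral_comp_shear {κ : NNReal} {h : E → ℝ} {v : E} (hc : Continuous h)
    (hb : ∀ b, |h b| ≤ 1)
    (hlip : ∀ b, LipschitzWith κ fun t : ℝ => t + h (b + t • v))
    (f : E → ENNReal) (hf : Measurable f) :
    ∫⁻ b, f b ≤ κ * ∫⁻ b, f (b + h b • v) := by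
  refine ennreal_le_of_forall_natCast_mul_le fun R => ?_
  have hhm : Measurable h := hc.measurable
  have key : ∀ b : E, ∫⁻ t in Set.Icc (1 : ℝ) (1 + R), f (b + t • v)
      ≤ κ * ∫⁻ t in Set.Icc (0 : ℝ) (0 + (R + 2)), f ((b + t • v) + h (b + t • v) • v) := by
    intro b
    set τ : ℝ → ℝ := fun t => t + h (b + t • v) with hτ
    have hτc : Continuous τ := (hlip b).continuous
    have hsurj : Function.Surjective τ :=
      surjective_id_add_of_bounded (by fun_prop) fun t => hb _
    set F : ℝ → ENNReal := (Set.Icc (1 : ℝ) (1 + R)).indicator fun t => f (b + t • v) with hF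
    have hFm : Measurable F := Measurable.indicator (by fun_prop) measurableSet_Icc
    calc ∫⁻ t in Set.Icc (1 : ℝ) (1 + R), f (b + t • v) = ∫⁻ t, F t := by
          rw [hF, lintegral_indicator measurableSet_Icc]
      _ ≤ ∫⁻ t, F t ∂((κ : ENNReal) • (volume : Measure ℝ).map τ) :=
          lintegral_mono' (volume_le_smul_map_of_lipschitz (hlip b) hsurj) le_rfl
      _ = κ * ∫⁻ t, F (τ t) := by
          rw [lintegral_smul_measure, lintegral_map hFm hτc.measurable, smul_eq_mul]
      _ ≤ κ * ∫⁻ t in Set.Icc (0 : ℝ) (0 + (R + 2)), f ((b + t • v) + h (b + t • v) • v) := by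
          rw [← lintegral_indicator measurableSet_Icc]
          gcongr with t
          by_cases ht : τ t ∈ Set.Icc (1 : ℝ) (1 + R)
          · have hbt := abs_le.1 (hb (b + t • v))
            have ht' : t ∈ Set.Icc (0 : ℝ) (0 + (R + 2)) := by
              simp only [hτ, Set.mem_Icc] at ht ⊢
              constructor <;> linarith
            rw [hF, Set.indicator_of_mem ht, Set.indicator_of_mem ht', hτ]
            simp only [add_smul, add_assoc]
            rfl
          · rw [hF, Set.indicator_of_notMem ht]
            exact zero_le
  have h1 := lintegral_mono (μ := (volume : Measure E)) key
  rw [lintegral_lintegral_segment f hf, lintegral_const_mul' _ _ (by simp),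
    lintegral_lintegral_segment (fun b => f (b + h b • v)) (by fun_prop)] at h1
  have h2 : ENNReal.ofReal ((R : ℝ) + 2) = (R : ENNReal) + 2 := by
    rw [ENNReal.ofReal_add (by positivity) (by norm_num)]; simp
  rw [ENNReal.ofReal_natCast, h2] at h1
  calc (R : ENNReal) * ∫⁻ b, f b ≤ _ := h1
    _ = _ := by ring

/-! ### The noise -/

lemma integrable_exp_neg_mul_norm {a : ℝ} (ha : 0 < a) :
    Integrable fun b : E => Real.exp (-(a * ‖b‖)) := by
  set N : ℕ := Module.finrank ℝ E + 1
  have hI : Integrable (fun b : E => (1 + ‖b‖) ^ (-(N : ℝ))) :=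
    integrable_one_add_norm (by simp [N])
  set c : ℝ := min a 1
  have hc : 0 < c := lt_min ha one_pos
  refine (hI.const_mul (N.factorial / c ^ N * Real.exp c)).mono'
    (by fun_prop) (Filter.Eventually.of_forall fun b => ?_)
  have hb : 0 < 1 + ‖b‖ := by positivity
  rw [Real.norm_eq_abs, Real.abs_exp, Real.rpow_neg hb.le, Real.rpow_natCast]
  have h1 := Real.pow_div_factorial_le_exp (c * (1 + ‖b‖)) (by positivity) N
  have h2 : Real.exp (-(a * ‖b‖)) ≤ Real.exp c * Real.exp (-(c * (1 + ‖b‖))) := by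
    rw [← Real.exp_add]
    apply Real.exp_le_exp.2
    nlinarith [norm_nonneg b, min_le_left a 1]
  refine h2.trans ?_
  rw [mul_comm _ (Real.exp c), mul_assoc]
  gcongr
  rw [Real.exp_neg, ← div_eq_mul_inv, div_div, inv_le_comm₀ (Real.exp_pos _) (by positivity)]
  calc ((N.factorial : ℝ) / (c ^ N * (1 + ‖b‖) ^ N))⁻¹ = (c * (1 + ‖b‖)) ^ N / N.factorial := by
        rw [inv_div, mul_pow]
    _ ≤ _ := h1

/-- The unnormalized law of the noise. -/
def noiseWeight (E : Type*) [NormedAddCommGroup E] [MeasureSpace E] (ε : ℝ) : Measure E :=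
  (volume : Measure E).withDensity fun b => ENNReal.ofReal (Real.exp (-(ε * ‖b‖ / 2)))

lemma noise_eq {E : Type*} [NormedAddCommGroup E] [MeasureSpace E] (ε : ℝ) :
    noise E ε = (noiseWeight E ε Set.univ)⁻¹ • noiseWeight E ε := by
  simp [noise, noiseWeight]

lemma isProbabilityMeasure_noise {ε : ℝ} (hε : 0 < ε) : IsProbabilityMeasure (noise E ε) := by
  have h0 : noiseWeight E ε Set.univ ≠ 0 := by
    rw [noiseWeight, withDensity_apply _ MeasurableSet.univ, Measure.restrict_univ,
      Ne, lintegral_eq_zero_iff (by fun_prop)]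
    intro h
    have h' : ∀ᵐ _ : E, False := h.mono fun b hb => by
      simp only [Pi.zero_apply, ENNReal.ofReal_eq_zero] at hb
      exact absurd hb (not_le.2 (Real.exp_pos _))
    exact NeZero.ne (volume : Measure E) (by simpa using h')
  have ht : noiseWeight E ε Set.univ ≠ ⊤ := by
    rw [noiseWeight, withDensity_apply _ MeasurableSet.univ, Measure.restrict_univ]
    have h := (integrable_exp_neg_mul_norm (E := E) (half_pos hε)).lintegral_lt_top.ne
    simpa [div_mul_eq_mul_div] using h
  refine ⟨?_⟩
  rw [noise_eq, Measure.smul_apply, smul_eq_mul, ENNReal.inv_mul_cancel h0 ht]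

/-- The law of `m` is dominated by that of `m'` if the two are conjugate by a shear that moves no
point far and that is Lipschitz along its direction. -/
lemma map_noise_le_of_shear {κ : NNReal} {ε q : ℝ} (hε : 0 ≤ ε) {h : E → ℝ} {v : E}
    (hc : Continuous h) (hb : ∀ b, |h b| ≤ 1) (hv : ‖v‖ ≤ q)
    (hlip : ∀ b, LipschitzWith κ fun t : ℝ => t + h (b + t • v))
    {O : Type*} [MeasurableSpace O] {m m' : E → O} (hm : Measurable m) (hm' : Measurable m')
    (hconj : ∀ b, m (b + h b • v) = m' b) :
    (noise E ε).map m ≤ ENNReal.ofReal (κ * Real.exp (ε * q / 2)) • (noise E ε).map m' := by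
  set p : E → ENNReal := fun b => ENNReal.ofReal (Real.exp (-(ε * ‖b‖ / 2))) with hp
  have hpm : Measurable p := by fun_prop
  have hw : (noiseWeight E ε).map m
      ≤ ENNReal.ofReal (κ * Real.exp (ε * q / 2)) • (noiseWeight E ε).map m' := by
    refine Measure.le_iff.2 fun S hS => ?_
    rw [Measure.smul_apply, Measure.map_apply hm hS, Measure.map_apply hm' hS, noiseWeight,
      withDensity_apply _ (hm hS), withDensity_apply _ (hm' hS), ← lintegral_indicator (hm hS),
      ← lintegral_indicator (hm' hS), smul_eq_mul]
    refine (lintegral_le_lintegral_comp_shear hc hb hlip _ (hpm.indicator (hm hS))).trans ?_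
    rw [ENNReal.ofReal_mul κ.coe_nonneg, ENNReal.ofReal_coe_nnreal, mul_assoc]
    refine mul_le_mul_right ?_ _
    rw [← lintegral_const_mul' _ _ ENNReal.ofReal_ne_top]
    refine lintegral_mono fun b => ?_
    by_cases hbS : b ∈ m' ⁻¹' S
    · have hbS' : b + h b • v ∈ m ⁻¹' S := by
        simpa only [Set.mem_preimage, hconj] using hbS
      rw [Set.indicator_of_mem hbS, Set.indicator_of_mem hbS', hp]
      dsimp only
      rw [← ENNReal.ofReal_mul (Real.exp_pos _).le, ← Real.exp_add]
      refine ENNReal.ofReal_le_ofReal (Real.exp_le_exp.2 ?_)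
      have h1 : ‖b‖ ≤ ‖b + h b • v‖ + q := by
        have h2 : ‖h b • v‖ ≤ q := by
          rw [norm_smul, Real.norm_eq_abs]
          nlinarith [hb b, norm_nonneg v, abs_nonneg (h b)]
        calc ‖b‖ = ‖(b + h b • v) - h b • v‖ := by simp
          _ ≤ _ := (norm_sub_le _ _).trans (by linarith)
      nlinarith
    · have hbS' : b + h b • v ∉ m ⁻¹' S := by
        simpa only [Set.mem_preimage, hconj] using hbS
      rw [Set.indicator_of_notMem hbS']
      exact zero_le
  rw [noise_eq, Measure.map_smul, Measure.map_smul, smul_comm]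
  exact Measure.le_iff.2 fun S _ => by
    simp only [Measure.smul_apply, smul_eq_mul]
    exact mul_le_mul_right (by simpa using hw S) _

end Shear

/-! ### Minimizers of strongly convex functions -/

section StrongConvex

variable {E : Type*} [NormedAddCommGroup E] [InnerProductSpace ℝ E] {f f' : E → ℝ} {μ : ℝ}

lemma IsMinimizer.add_sq_le (hf : StrongConvexOn Set.univ μ f) {w : E} (hw : IsMinimizer f w)
    (u : E) : f w + μ / 2 * ‖u - w‖ ^ 2 ≤ f u := by
  have key : ∀ t ∈ Set.Ioo (0 : ℝ) 1, f w + (1 - t) * (μ / 2 * ‖u - w‖ ^ 2) ≤ f u := by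
    rintro t ⟨h0, h1⟩
    have h := hf.2 (Set.mem_univ u) (Set.mem_univ w) h0.le (sub_nonneg.2 h1.le) (by ring)
    have h' := (hw _).trans h
    simp only [smul_eq_mul] at h'
    refine le_of_mul_le_mul_left ?_ h0
    linarith
  have hT : Filter.Tendsto (fun t : ℝ => f w + (1 - t) * (μ / 2 * ‖u - w‖ ^ 2))
      (nhdsWithin 0 (Set.Ioi 0)) (nhds (f w + (1 - 0) * (μ / 2 * ‖u - w‖ ^ 2))) :=
    (Continuous.tendsto (by fun_prop) _).mono_left nhdsWithin_le_nhds
  have := le_of_tendsto hT (Filter.mem_of_superset (Ioo_mem_nhdsGT one_pos) key)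
  simpa using this

lemma IsMinimizer.eq (hf : StrongConvexOn Set.univ μ f) (hμ : 0 < μ) {w u : E}
    (hw : IsMinimizer f w) (hu : IsMinimizer f u) : u = w := by
  have h := hw.add_sq_le hf u
  have h2 : ‖u - w‖ ^ 2 ≤ 0 := by nlinarith [hu w]
  exact sub_eq_zero.1 (norm_eq_zero.1 (pow_eq_zero_iff two_ne_zero |>.1
    (le_antisymm h2 (sq_nonneg _))))

/-- The distance of the minimizers of two strongly convex functions is controlled by the variation
of the difference of the functions. -/
lemma IsMinimizer.sq_le (hf : StrongConvexOn Set.univ μ f) (hf' : StrongConvexOn Set.univ μ f')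
    {w w' : E} (hw : IsMinimizer f w) (hw' : IsMinimizer f' w') :
    μ * ‖w - w'‖ ^ 2 ≤ (f w' - f' w') - (f w - f' w) := by
  have h1 := hw.add_sq_le hf w'
  have h2 := hw'.add_sq_le hf' w
  rw [norm_sub_rev] at h1
  linarith

lemma exists_isMinimizer [FiniteDimensional ℝ E] (hf : StrongConvexOn Set.univ μ f) (hμ : 0 < μ) :
    ∃ w, IsMinimizer f w := by
  have hcont : Continuous f := continuousOn_univ.1
    ((hf.strictConvexOn hμ).convexOn.continuousOn isOpen_univ)
  obtain ⟨z, -, hz⟩ := (isCompact_closedBall (0 : E) 1).exists_isMinOn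
    ⟨0, by simp⟩ hcont.continuousOn
  refine hcont.exists_forall_le_of_isBounded 0 ?_
  refine (Metric.isBounded_closedBall (x := (0 : E)) (r := 1 + 2 * (f 0 - f z) / μ)).subset ?_
  intro u hu
  rw [mem_closedBall_zero_iff]
  have hz0 : f z ≤ f 0 := hz (by simp)
  by_cases h1 : ‖u‖ ≤ 1
  · have : 0 ≤ 2 * (f 0 - f z) / μ := div_nonneg (by linarith) hμ.le
    linarith
  push Not at h1
  have h0 : 0 < ‖u‖ := one_pos.trans h1
  set t : ℝ := ‖u‖⁻¹ with ht
  have ht0 : 0 < t := inv_pos.2 h0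
  have ht1 : t ≤ 1 := inv_le_one_of_one_le₀ h1.le
  have htu : t * ‖u‖ = 1 := inv_mul_cancel₀ h0.ne'
  have h := hf.2 (Set.mem_univ u) (Set.mem_univ 0) ht0.le (sub_nonneg.2 ht1) (by ring)
  have hzt : f z ≤ f (t • u + (1 - t) • 0) := hz (by
    simp [norm_smul, abs_of_pos ht0, htu])
  simp only [smul_eq_mul, sub_zero] at h
  have hu' : f u ≤ f 0 := hu
  have h2 : f z ≤ f 0 - (1 - t) * (μ / 2 * ‖u‖) := by
    have h3 : t * (1 - t) * (μ / 2 * ‖u‖ ^ 2) = (t * ‖u‖) * ((1 - t) * (μ / 2 * ‖u‖)) := by ring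
    rw [h3, htu, one_mul] at h
    nlinarith
  have h4 : (1 - t) * (μ / 2 * ‖u‖) = μ / 2 * (‖u‖ - t * ‖u‖) := by ring
  rw [h4, htu] at h2
  rw [← sub_le_iff_le_add', le_div_iff₀ hμ]
  linarith

lemma existsUnique_isMinimizer [FiniteDimensional ℝ E] (hf : StrongConvexOn Set.univ μ f)
    (hμ : 0 < μ) : ∃! w, IsMinimizer f w := by
  obtain ⟨w, hw⟩ := exists_isMinimizer hf hμ
  exact ⟨w, hw, fun u hu => hw.eq hf hμ hu⟩

lemma isMinimizer_argmin [FiniteDimensional ℝ E] (hf : StrongConvexOn Set.univ μ f)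
    (hμ : 0 < μ) : IsMinimizer f (argmin f) :=
  Classical.epsilon_spec (exists_isMinimizer hf hμ)

end StrongConvex

/-! ### The logistic loss -/

/-- The derivative of the logistic loss with respect to the prediction. -/
def logLossSlope (yhat y : ℝ) : ℝ := -y * Real.sigmoid (-y * yhat)

lemma log_one_add_exp_tangent (a b : ℝ) :
    Real.log (1 + Real.exp a) + Real.sigmoid a * (b - a) ≤ Real.log (1 + Real.exp b) := by
  have hσ0 := Real.sigmoid_pos a
  have hσ1 := Real.sigmoid_le_one a
  have h := convexOn_exp.2 (Set.mem_univ (b - a)) (Set.mem_univ 0) hσ0.le (sub_nonneg.2 hσ1)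
    (by ring)
  simp only [smul_eq_mul, mul_zero, add_zero, Real.exp_zero, mul_one] at h
  rw [Real.le_log_iff_exp_le (by positivity), Real.exp_add, Real.exp_log (by positivity)]
  have hs : Real.sigmoid a * (1 + Real.exp a) = Real.exp a := by
    rw [Real.sigmoid_def, Real.exp_neg]
    field_simp
    ring
  calc (1 + Real.exp a) * Real.exp (Real.sigmoid a * (b - a))
      ≤ (1 + Real.exp a) * (Real.sigmoid a * Real.exp (b - a) + (1 - Real.sigmoid a)) := by gcongr
    _ = (Real.sigmoid a * (1 + Real.exp a)) * Real.exp (b - a)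
        + (1 + Real.exp a - Real.sigmoid a * (1 + Real.exp a)) := by ring
    _ = 1 + Real.exp b := by
        rw [hs, ← Real.exp_add]; ring_nf

lemma logLoss_tangent (t u y : ℝ) :
    logLoss t y + logLossSlope t y * (u - t) ≤ logLoss u y := by
  have := log_one_add_exp_tangent (-y * t) (-y * u)
  unfold logLoss logLossSlope
  linarith

lemma abs_logLossSlope_le {t y : ℝ} (hy : |y| ≤ 1) : |logLossSlope t y| ≤ 1 := by
  rw [logLossSlope, abs_mul, abs_neg, abs_of_pos (Real.sigmoid_pos _)]
  nlinarith [Real.sigmoid_pos (-y * t), Real.sigmoid_le_one (-y * t), abs_nonneg y]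

lemma abs_sigmoid_sub_le (a b : ℝ) : |Real.sigmoid a - Real.sigmoid b| ≤ 1 / 4 * |a - b| := by
  have h := Convex.norm_image_sub_le_of_norm_hasDerivWithin_le (f := Real.sigmoid)
    (f' := fun x => Real.sigmoid x * (1 - Real.sigmoid x)) (C := 1 / 4) (s := Set.univ)
    (x := b) (y := a) (fun x _ => (Real.hasDerivAt_sigmoid x).hasDerivWithinAt)
    (fun x _ => by
      have h0 := Real.sigmoid_nonneg x
      have h1 := Real.sigmoid_le_one x
      rw [Real.norm_eq_abs, abs_of_nonneg (mul_nonneg h0 (by linarith))]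
      nlinarith [sq_nonneg (Real.sigmoid x - 1 / 2)])
    convex_univ (Set.mem_univ _) (Set.mem_univ _)
  simpa [Real.norm_eq_abs] using h

lemma abs_logLossSlope_sub_le {t u y : ℝ} (hy : |y| ≤ 1) :
    |logLossSlope t y - logLossSlope u y| ≤ 1 / 4 * |t - u| := by
  have h := abs_sigmoid_sub_le (-y * t) (-y * u)
  rw [← mul_sub, abs_mul, abs_neg] at h
  rw [logLossSlope, logLossSlope, ← mul_sub, abs_mul, abs_neg]
  have h0 := abs_nonneg (t - u)
  have h1 := abs_nonneg (Real.sigmoid (-y * t) - Real.sigmoid (-y * u))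
  have h2 : |y| * |t - u| ≤ |t - u| := by nlinarith [abs_nonneg y]
  nlinarith [abs_nonneg y]

lemma abs_logLoss_sub_le {t u y : ℝ} (hy : |y| ≤ 1) : |logLoss t y - logLoss u y| ≤ |t - u| := by
  have h1 := logLoss_tangent t u y
  have h2 := logLoss_tangent u t y
  have h3 : ∀ v, |logLossSlope v y * (t - u)| ≤ |t - u| := fun v => by
    rw [abs_mul]
    nlinarith [abs_logLossSlope_le (t := v) hy, abs_nonneg (t - u)]
  have h4 := abs_le.1 (h3 t)
  have h5 := abs_le.1 (h3 u)
  rw [abs_le]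
  constructor <;> nlinarith

section Objective

variable {E : Type*} [NormedAddCommGroup E] [InnerProductSpace ℝ E]

lemma convexOn_logLoss_inner (x : E) (y : ℝ) :
    ConvexOn ℝ Set.univ fun w : E => logLoss (inner ℝ w x) y := by
  refine ⟨convex_univ, fun u _ v _ a b ha hb hab => ?_⟩
  set t : ℝ := inner ℝ (a • u + b • v) x with ht
  have h1 := logLoss_tangent t (inner ℝ u x) y
  have h2 := logLoss_tangent t (inner ℝ v x) y
  have h3 : t = a * inner ℝ u x + b * inner ℝ v x := by
    rw [ht, inner_add_left, real_inner_smul_left, real_inner_smul_left]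
  have h4 : a * (inner ℝ u x - t) + b * (inner ℝ v x - t) = 0 := by
    have : (a + b) * t = t := by rw [hab, one_mul]
    linarith
  have h5 := mul_le_mul_of_nonneg_left h1 ha
  have h6 := mul_le_mul_of_nonneg_left h2 hb
  have h7 : (a + b) * logLoss t y = logLoss t y := by rw [hab, one_mul]
  have h8 : logLossSlope t y * (a * (inner ℝ u x - t) + b * (inner ℝ v x - t)) = 0 := by
    rw [h4, mul_zero]
  simp only [smul_eq_mul]
  change logLoss t y ≤ _
  nlinarith

/-! ### The objective -/

/-- The part of the objective that does not depend on the noise, with `N` for the number of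
samples. -/
def riskPart {ι : Type*} (N : ℝ) (I : Finset ι) (x : ι → E) (y : ι → ℝ) (Δ lam : ℝ) (g : E → ℝ)
    (w : E) : ℝ :=
  1 / N * ∑ i ∈ I, logLoss (inner ℝ w (x i)) (y i) + (Δ * ‖w‖ ^ 2 / 2 + lam * g w)

/-- The linear perturbation of `F` by the noise. -/
def perturb (N : ℝ) (F : E → ℝ) (b w : E) : ℝ := F w + inner ℝ b w / N

lemma objective_eq_perturb {ι : Type*} (I : Finset ι) (x : ι → E) (y : ι → ℝ) (b : E)
    (Δ lam : ℝ) (g : E → ℝ) :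
    objective I x y b Δ lam g = perturb I.card (riskPart I.card I x y Δ lam g) b := by
  funext w
  simp only [objective, perturb, riskPart]
  ring

lemma strongConvexOn_regularizer {Δ lam : ℝ} {g : E → ℝ} (hlam : 0 ≤ lam)
    (hg : StrongConvexOn Set.univ 1 g) :
    StrongConvexOn Set.univ (lam + Δ) fun w => Δ * ‖w‖ ^ 2 / 2 + lam * g w := by
  rw [strongConvexOn_iff_convex] at hg ⊢
  refine (hg.smul hlam).congr fun w _ => ?_
  simp only [smul_eq_mul]
  ring

lemma StrongConvexOn.convexOn_add {F G : E → ℝ} {μ : ℝ} (hF : ConvexOn ℝ Set.univ F)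
    (hG : StrongConvexOn Set.univ μ G) : StrongConvexOn Set.univ μ fun w => F w + G w := by
  rw [strongConvexOn_iff_convex] at hG ⊢
  refine (hF.add hG).congr fun w _ => ?_
  simp only [Pi.add_apply]
  ring

lemma strongConvexOn_riskPart {ι : Type*} {N : ℝ} (hN : 0 ≤ N) (I : Finset ι) (x : ι → E)
    (y : ι → ℝ) {Δ lam : ℝ} {g : E → ℝ} (hlam : 0 ≤ lam) (hg : StrongConvexOn Set.univ 1 g) :
    StrongConvexOn Set.univ (lam + Δ) (riskPart N I x y Δ lam g) := by
  refine StrongConvexOn.convexOn_add ?_ (strongConvexOn_regularizer hlam hg)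
  have h : ConvexOn ℝ Set.univ fun w : E => ∑ i ∈ I, logLoss (inner ℝ w (x i)) (y i) := by
    classical
    induction I using Finset.induction_on with
    | empty => simpa using convexOn_const (0 : ℝ) convex_univ
    | insert i s hi ih =>
      simp only [Finset.sum_insert hi]
      exact (convexOn_logLoss_inner (x i) (y i)).add ih
  exact h.smul (one_div_nonneg.2 hN)

lemma strongConvexOn_perturb {N μ : ℝ} {F : E → ℝ} (hF : StrongConvexOn Set.univ μ F) (b : E) :
    StrongConvexOn Set.univ μ (perturb N F b) := by
  have h : ConvexOn ℝ Set.univ fun w : E => inner ℝ b w / N := by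
    refine ⟨convex_univ, fun u _ v _ a c _ _ _ => le_of_eq ?_⟩
    simp only [inner_add_right, real_inner_smul_right, smul_eq_mul]
    ring
  have h2 := StrongConvexOn.convexOn_add h hF
  have h3 : perturb N F b = fun w => inner ℝ b w / N + F w := funext fun w => add_comm _ _
  rwa [h3]

/-- Minimizers depend on the noise in a Lipschitz way. -/
lemma norm_sub_le_of_isMinimizer_perturb {N μ : ℝ} (hN : 0 < N) (hμ : 0 < μ) {F : E → ℝ}
    (hF : StrongConvexOn Set.univ μ F) {b b' w w' : E} (hw : IsMinimizer (perturb N F b) w)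
    (hw' : IsMinimizer (perturb N F b') w') : ‖w - w'‖ ≤ ‖b - b'‖ / (N * μ) := by
  have h := hw.sq_le (strongConvexOn_perturb hF b) (strongConvexOn_perturb hF b') hw'
  have h1 : (perturb N F b w' - perturb N F b' w') - (perturb N F b w - perturb N F b' w)
      = - inner ℝ (b - b') (w - w') / N := by
    simp only [perturb, inner_sub_left, inner_sub_right]
    ring
  rw [h1, le_div_iff₀ hN] at h
  have h2 := (abs_le.1 (abs_real_inner_le_norm (b - b') (w - w'))).1
  rw [le_div_iff₀ (by positivity)]
  rcases (norm_nonneg (w - w')).eq_or_lt with h0 | h0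
  · rw [← h0, zero_mul]; positivity
  · refine le_of_mul_le_mul_right ?_ h0
    nlinarith

/-- Adding a sample to the empirical risk is compensated by a shift of the noise. -/
lemma IsMinimizer.perturb_add {N : ℝ} (hN : 0 < N) {F F' : E → ℝ} {x : E} {y : ℝ}
    (hF' : ∀ w, F' w = F w + 1 / N * logLoss (inner ℝ w x) y) {b w : E}
    (hw : IsMinimizer (perturb N F b) w) :
    IsMinimizer (perturb N F' (b + (-logLossSlope (inner ℝ w x) y) • x)) w := by
  intro u
  have h1 := hw u
  have h2 := logLoss_tangent (inner ℝ w x) (inner ℝ u x) y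
  simp only [perturb, hF', inner_add_left, real_inner_smul_left, ← real_inner_comm x] at h1 ⊢
  have h3 := mul_le_mul_of_nonneg_left h2 (one_div_nonneg.2 hN.le)
  simp only [div_eq_mul_inv, one_mul] at h1 h3 ⊢
  nlinarith

/-- Removing a sample from the empirical risk is compensated by a shift of the noise. -/
lemma IsMinimizer.perturb_remove {N : ℝ} (hN : 0 < N) {F F' : E → ℝ} {x : E} {y : ℝ}
    (hy : |y| ≤ 1) (hF : ConvexOn ℝ Set.univ F)
    (hF' : ∀ w, F' w = F w + 1 / N * logLoss (inner ℝ w x) y) {b w : E}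
    (hw : IsMinimizer (perturb N F' b) w) :
    IsMinimizer (perturb N F (b + logLossSlope (inner ℝ w x) y • x)) w := by
  set b' : E := b + logLossSlope (inner ℝ w x) y • x with hb'
  have hquad : ∀ u, perturb N F b' w
      ≤ perturb N F b' u + 1 / (4 * N) * (inner ℝ u x - inner ℝ w x) ^ 2 := by
    intro u
    have h1 := hw u
    have h2 := logLoss_tangent (inner ℝ u x) (inner ℝ w x) y
    set δ : ℝ := inner ℝ u x - inner ℝ w x with hδ
    have h3 : (logLossSlope (inner ℝ u x) y - logLossSlope (inner ℝ w x) y) * δ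
        ≤ 1 / 4 * δ ^ 2 := by
      refine (le_abs_self _).trans ?_
      rw [abs_mul, ← sq_abs δ, sq, ← mul_assoc]
      exact mul_le_mul_of_nonneg_right (abs_logLossSlope_sub_le hy) (abs_nonneg _)
    have h4 : logLoss (inner ℝ u x) y - logLoss (inner ℝ w x) y
        - logLossSlope (inner ℝ w x) y * δ ≤ 1 / 4 * δ ^ 2 := by
      have : inner ℝ w x - inner ℝ u x = -δ := by rw [hδ]; ring
      rw [this] at h2
      linarith
    have h5 := mul_le_mul_of_nonneg_left h4 (inv_nonneg.2 hN.le)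
    simp only [perturb, hF', hb', inner_add_left, real_inner_smul_left, ← real_inner_comm x]
      at h1 ⊢
    simp only [div_eq_mul_inv, one_mul, mul_inv] at h1 h5 ⊢
    rw [hδ] at h5 ⊢
    nlinarith
  have hconv : ConvexOn ℝ Set.univ (perturb N F b') :=
    strongConvexOn_zero.1 (strongConvexOn_perturb (strongConvexOn_zero.2 hF) b')
  intro v
  set c : ℝ := 1 / (4 * N) * (inner ℝ v x - inner ℝ w x) ^ 2 with hc
  have key : ∀ t ∈ Set.Ioo (0 : ℝ) 1, perturb N F b' w ≤ perturb N F b' v + t * c := by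
    rintro t ⟨h0, h1⟩
    have h := hconv.2 (Set.mem_univ v) (Set.mem_univ w) h0.le (sub_nonneg.2 h1.le) (by ring)
    have h2 := hquad (t • v + (1 - t) • w)
    have h3 : inner ℝ (t • v + (1 - t) • w) x - inner ℝ w x
        = t * (inner ℝ v x - inner ℝ w x) := by
      rw [inner_add_left, real_inner_smul_left, real_inner_smul_left]; ring
    rw [h3] at h2
    simp only [smul_eq_mul] at h
    refine le_of_mul_le_mul_left ?_ h0
    rw [hc]
    linarith
  have hT : Filter.Tendsto (fun t : ℝ => perturb N F b' v + t * c)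
      (nhdsWithin 0 (Set.Ioi 0)) (nhds (perturb N F b' v + 0 * c)) :=
    (Continuous.tendsto (by fun_prop) _).mono_left nhdsWithin_le_nhds
  simpa using ge_of_tendsto hT (Filter.mem_of_superset (Ioo_mem_nhdsGT one_pos) key)

/-- The minimizer of the objective depends continuously on the feature vectors and the noise. -/
lemma continuous_argmin_objective [FiniteDimensional ℝ E] {ι : Type*} {I : Finset ι}
    (hI : I.Nonempty) {y : ι → ℝ} (hy : ∀ i, |y i| ≤ 1) {Δ lam : ℝ} {g : E → ℝ} (hlam : 0 ≤ lam)
    (hμ : 0 < lam + Δ) (hg : StrongConvexOn Set.univ 1 g) :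
    Continuous fun p : (ι → E) × E => argmin (objective I p.1 y p.2 Δ lam g) := by
  have hN : (0 : ℝ) < I.card := by exact_mod_cast hI.card_pos
  have hsc : ∀ p : (ι → E) × E, StrongConvexOn Set.univ (lam + Δ) (objective I p.1 y p.2 Δ lam g) :=
    fun p => by
      rw [objective_eq_perturb]
      exact strongConvexOn_perturb (strongConvexOn_riskPart hN.le _ _ _ hlam hg) _
  set m : (ι → E) × E → E := fun p => argmin (objective I p.1 y p.2 Δ lam g) with hm
  have hmin : ∀ p, IsMinimizer (objective I p.1 y p.2 Δ lam g) (m p) :=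
    fun p => isMinimizer_argmin (hsc p) hμ
  refine continuous_iff_continuousAt.2 fun p₀ => ?_
  set μ := lam + Δ
  set δ : (ι → E) × E → ℝ :=
    fun p => 1 / (I.card : ℝ) * (∑ i ∈ I, ‖p.1 i - p₀.1 i‖ + ‖p.2 - p₀.2‖) with hδ
  have hδ0 : ∀ p, 0 ≤ δ p := fun p => by positivity
  have hδc : Filter.Tendsto δ (nhds p₀) (nhds 0) := by
    have h : Continuous δ := by fun_prop
    simpa [hδ] using h.tendsto p₀
  have hdiff : ∀ p u, |objective I p.1 y p.2 Δ lam g u - objective I p₀.1 y p₀.2 Δ lam g u|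
      ≤ δ p * ‖u‖ := by
    intro p u
    have h1 : objective I p.1 y p.2 Δ lam g u - objective I p₀.1 y p₀.2 Δ lam g u
        = 1 / (I.card : ℝ) * (∑ i ∈ I, (logLoss (inner ℝ u (p.1 i)) (y i)
            - logLoss (inner ℝ u (p₀.1 i)) (y i)) + inner ℝ (p.2 - p₀.2) u) := by
      simp only [objective, Finset.sum_sub_distrib, inner_sub_left]
      ring
    rw [h1, abs_mul, abs_of_nonneg (by positivity), hδ, mul_assoc, add_mul, Finset.sum_mul]
    gcongr
    refine (abs_add_le _ _).trans (add_le_add ((Finset.abs_sum_le_sum_abs _ _).trans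
      (Finset.sum_le_sum fun i _ => ?_)) (abs_real_inner_le_norm _ _))
    refine (abs_logLoss_sub_le (hy i)).trans ?_
    rw [← inner_sub_right, mul_comm]
    exact abs_real_inner_le_norm _ _
  have hbound : ∀ p, μ * ‖m p - m p₀‖ ^ 2 ≤ δ p * (2 * ‖m p₀‖ + ‖m p - m p₀‖) := by
    intro p
    have h := (hmin p).sq_le (hsc p) (hsc p₀) (hmin p₀)
    have h1 := (abs_le.1 (hdiff p (m p₀))).2
    have h2 := (abs_le.1 (hdiff p (m p))).1
    have h3 : ‖m p‖ ≤ ‖m p₀‖ + ‖m p - m p₀‖ := by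
      have := norm_add_le (m p₀) (m p - m p₀)
      rwa [add_sub_cancel] at this
    nlinarith [hδ0 p]
  have hsq : Filter.Tendsto (fun p => ‖m p - m p₀‖ ^ 2) (nhds p₀) (nhds 0) := by
    have hlim : Filter.Tendsto (fun p => 2 / μ * (2 * ‖m p₀‖ + 1) * δ p) (nhds p₀) (nhds 0) := by
      simpa using hδc.const_mul (2 / μ * (2 * ‖m p₀‖ + 1))
    refine tendsto_of_tendsto_of_tendsto_of_le_of_le' tendsto_const_nhds hlim
      (Filter.Eventually.of_forall fun p => sq_nonneg _) ?_
    filter_upwards [hδc.eventually (gt_mem_nhds (half_pos hμ))] with p hp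
    have h := hbound p
    have h1 : ‖m p - m p₀‖ ≤ 1 + ‖m p - m p₀‖ ^ 2 := by nlinarith [sq_nonneg (‖m p - m p₀‖ - 1)]
    have h2 : δ p * ‖m p - m p₀‖ ≤ δ p + μ / 2 * ‖m p - m p₀‖ ^ 2 := by
      nlinarith [hδ0 p, sq_nonneg ‖m p - m p₀‖]
    have h3 : μ / 2 * ‖m p - m p₀‖ ^ 2 ≤ (2 * ‖m p₀‖ + 1) * δ p := by linarith
    rw [show 2 / μ * (2 * ‖m p₀‖ + 1) * δ p = (2 * ‖m p₀‖ + 1) * δ p / (μ / 2) by field_simp,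
      le_div_iff₀ (half_pos hμ)]
    linarith
  refine tendsto_iff_norm_sub_tendsto_zero.2 ?_
  simpa [Function.comp_def] using (Real.continuous_sqrt.tendsto 0).comp hsq

end Objective

/-! ### Privacy of objective perturbation -/

section Law

variable {E : Type*} [NormedAddCommGroup E] [InnerProductSpace ℝ E] [FiniteDimensional ℝ E]

lemma norm_argmin_perturb_sub_le {N μ : ℝ} (hN : 0 < N) (hμ : 0 < μ) {F : E → ℝ}
    (hF : StrongConvexOn Set.univ μ F) (b b' : E) :
    ‖argmin (perturb N F b) - argmin (perturb N F b')‖ ≤ ‖b - b'‖ / (N * μ) :=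
  norm_sub_le_of_isMinimizer_perturb hN hμ hF
    (isMinimizer_argmin (strongConvexOn_perturb hF b) hμ)
    (isMinimizer_argmin (strongConvexOn_perturb hF b') hμ)

lemma continuous_argmin_perturb {N μ : ℝ} (hN : 0 < N) (hμ : 0 < μ) {F : E → ℝ}
    (hF : StrongConvexOn Set.univ μ F) : Continuous fun b => argmin (perturb N F b) := by
  refine (LipschitzWith.of_dist_le_mul (K := Real.toNNReal (N * μ)⁻¹) fun b b' => ?_).continuous
  rw [Real.coe_toNNReal _ (by positivity), dist_eq_norm, dist_eq_norm, mul_comm, ← div_eq_mul_inv]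
  exact norm_argmin_perturb_sub_le hN hμ hF b b'

variable [MeasureSpace E] [BorelSpace E] [(volume : Measure E).IsAddHaarMeasure]

/-- The laws of two minimizers are comparable if a shift of the noise by a multiple of the gradient
of the loss of one sample turns one minimizer into the other. -/
lemma map_noise_argmin_perturb_le {N μ ε q σ y : ℝ} (hN : 0 < N) (hμ : 0 < μ) (hε : 0 ≤ ε)
    (hσ : |σ| = 1) (hy : |y| ≤ 1) {x : E} (hx : ‖x‖ ≤ q) {F F' : E → ℝ}
    (hF : StrongConvexOn Set.univ μ F) (hF' : StrongConvexOn Set.univ μ F')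
    (hconj : ∀ b w, IsMinimizer (perturb N F b) w →
      IsMinimizer (perturb N F' (b + (σ * logLossSlope (inner ℝ w x) y) • x)) w) :
    (noise E ε).map (fun b => argmin (perturb N F' b))
      ≤ ENNReal.ofReal ((1 + q ^ 2 / (4 * N * μ)) * Real.exp (ε * q / 2))
        • (noise E ε).map (fun b => argmin (perturb N F b)) := by
  have hq : 0 ≤ q := (norm_nonneg x).trans hx
  have hκ : 0 ≤ 1 + q ^ 2 / (4 * N * μ) := by positivity
  set h : E → ℝ := fun b => σ * logLossSlope (inner ℝ (argmin (perturb N F b)) x) y with hh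
  have hdiff : ∀ b b', |h b - h b'| ≤ q / (4 * N * μ) * ‖b - b'‖ := by
    intro b b'
    rw [hh, ← mul_sub, abs_mul, hσ, one_mul]
    refine (abs_logLossSlope_sub_le hy).trans ?_
    rw [← inner_sub_left]
    calc 1 / 4 * |inner ℝ (argmin (perturb N F b) - argmin (perturb N F b')) x|
        ≤ 1 / 4 * (‖b - b'‖ / (N * μ) * q) := by
          gcongr
          refine (abs_real_inner_le_norm _ _).trans ?_
          gcongr
          exact norm_argmin_perturb_sub_le hN hμ hF b b'
      _ = _ := by field_simp
  have hc : Continuous h := by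
    refine (LipschitzWith.of_dist_le_mul (K := Real.toNNReal (q / (4 * N * μ)))
      fun b b' => ?_).continuous
    rw [Real.coe_toNNReal _ (by positivity), dist_eq_norm, dist_eq_norm]
    exact hdiff b b'
  have hb : ∀ b, |h b| ≤ 1 := fun b => by
    rw [hh, abs_mul, hσ, one_mul]
    exact abs_logLossSlope_le hy
  have hlip : ∀ b, LipschitzWith (Real.toNNReal (1 + q ^ 2 / (4 * N * μ)))
      fun t : ℝ => t + h (b + t • x) := by
    intro b
    refine LipschitzWith.of_dist_le_mul fun t t' => ?_
    rw [Real.coe_toNNReal _ hκ, Real.dist_eq, Real.dist_eq]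
    have h1 := hdiff (b + t • x) (b + t' • x)
    rw [add_sub_add_left_eq_sub, ← sub_smul, norm_smul, Real.norm_eq_abs] at h1
    have h2 : q / (4 * N * μ) * (|t - t'| * ‖x‖) ≤ q / (4 * N * μ) * (|t - t'| * q) := by
      gcongr
    calc |t + h (b + t • x) - (t' + h (b + t' • x))|
        = |(t - t') + (h (b + t • x) - h (b + t' • x))| := by ring_nf
      _ ≤ |t - t'| + q / (4 * N * μ) * (|t - t'| * q) :=
          (abs_add_le _ _).trans (by linarith)
      _ = _ := by ring
  have := map_noise_le_of_shear hε hc hb hx hlip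
    (continuous_argmin_perturb hN hμ hF').measurable
    (continuous_argmin_perturb hN hμ hF).measurable fun b =>
      (IsMinimizer.eq (strongConvexOn_perturb hF' _) hμ
        (isMinimizer_argmin (strongConvexOn_perturb hF' _) hμ)
        (hconj b _ (isMinimizer_argmin (strongConvexOn_perturb hF b) hμ))).symm
  rwa [Real.coe_toNNReal _ hκ] at this

/-- Objective perturbation: replacing one sample changes the law of the minimizer by a bounded
factor. -/
lemma map_noise_argmin_objective_le {ι : Type*} {I : Finset ι} {i : ι} (hi : i ∈ I)
    {x x' : ι → E} {y y' : ι → ℝ} (hxx' : ∀ j, j ≠ i → x j = x' j) (hyy' : ∀ j, j ≠ i → y j = y' j)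
    {ε q Δ lam : ℝ} {g : E → ℝ} (hx : ‖x i‖ ≤ q) (hx' : ‖x' i‖ ≤ q) (hy : |y i| ≤ 1)
    (hy' : |y' i| ≤ 1) (hε : 0 ≤ ε) (hlam : 0 ≤ lam) (hμ : 0 < lam + Δ)
    (hg : StrongConvexOn Set.univ 1 g) :
    (noise E ε).map (fun b => argmin (objective I x y b Δ lam g))
      ≤ ENNReal.ofReal ((1 + q ^ 2 / (4 * I.card * (lam + Δ))) ^ 2 * Real.exp (ε * q))
        • (noise E ε).map (fun b => argmin (objective I x' y' b Δ lam g)) := by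
  classical
  have hN : (0 : ℝ) < I.card := by exact_mod_cast Finset.card_pos.2 ⟨i, hi⟩
  set F₀ : E → ℝ := riskPart I.card (I.erase i) x y Δ lam g with hF₀
  have hF₀' : F₀ = riskPart I.card (I.erase i) x' y' Δ lam g := by
    funext w
    simp only [hF₀, riskPart]
    congr 2
    refine Finset.sum_congr rfl fun j hj => ?_
    rw [hxx' j (Finset.ne_of_mem_erase hj), hyy' j (Finset.ne_of_mem_erase hj)]
  have hadd : ∀ (x : ι → E) (y : ι → ℝ) (w : E), riskPart I.card I x y Δ lam g w
      = riskPart I.card (I.erase i) x y Δ lam g w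
        + 1 / (I.card : ℝ) * logLoss (inner ℝ w (x i)) (y i) := by
    intro x y w
    simp only [riskPart, ← Finset.add_sum_erase I _ hi]
    ring
  have hsc : ∀ (J : Finset ι) (x : ι → E) (y : ι → ℝ),
      StrongConvexOn Set.univ (lam + Δ) (riskPart I.card J x y Δ lam g) :=
    fun J x y => strongConvexOn_riskPart hN.le J x y hlam hg
  have hstep1 := map_noise_argmin_perturb_le (σ := -1) hN hμ hε (by simp) hy hx
    (hsc (I.erase i) x y) (hsc I x y) fun b w hw => by
      rw [neg_one_mul]
      exact hw.perturb_add hN (hadd x y)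
  have hstep2 := map_noise_argmin_perturb_le (σ := 1) hN hμ hε (by simp) hy' hx'
    (hsc I x' y') (hsc (I.erase i) x' y') fun b w hw => by
      rw [one_mul]
      exact hw.perturb_remove hN hy' ((hsc (I.erase i) x' y').strictConvexOn hμ).convexOn
        (hadd x' y')
  rw [← hF₀] at hstep1
  rw [← hF₀'] at hstep2
  simp only [objective_eq_perturb]
  refine Measure.le_iff.2 fun S _ => (hstep1 S).trans ?_
  rw [Measure.smul_apply, Measure.smul_apply, smul_eq_mul, smul_eq_mul]
  refine (mul_le_mul_right (hstep2 S) _).trans (le_of_eq ?_)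
  rw [Measure.smul_apply, smul_eq_mul, ← mul_assoc, ← ENNReal.ofReal_mul (by positivity)]
  congr 2
  have : Real.exp (ε * q) = Real.exp (ε * q / 2) * Real.exp (ε * q / 2) := by
    rw [← Real.exp_add]; ring_nf
  rw [this]
  ring

end Law

/-! ### Products of comparable measures -/

lemma measure_pi_le_smul_pi {ι : Type*} [Fintype ι] {α : ι → Type*} [∀ i, MeasurableSpace (α i)]
    {μ ν : ∀ i, Measure (α i)} [∀ i, SigmaFinite (μ i)] [∀ i, SigmaFinite (ν i)]
    {c : ι → ENNReal} (hc0 : ∀ i, c i ≠ 0) (hc : ∀ i, c i ≠ ⊤) (h : ∀ i, μ i ≤ c i • ν i) :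
    Measure.pi μ ≤ (∏ i, c i) • Measure.pi ν := by
  have hp0 : ∏ i, c i ≠ 0 := Finset.prod_ne_zero_iff.2 fun i _ => hc0 i
  have hpt : ∏ i, c i ≠ ⊤ := ENNReal.prod_ne_top fun i _ => hc i
  have key : (∏ i, c i)⁻¹ • (Measure.pi μ).toOuterMeasure
      ≤ OuterMeasure.pi fun i => (ν i).toOuterMeasure := by
    rw [OuterMeasure.le_pi]
    intro s _
    rw [smul_apply, smul_eq_mul]
    change _ * Measure.pi μ _ ≤ _
    rw [Measure.pi_pi]
    refine (ENNReal.inv_mul_le_iff hp0 hpt).2 ?_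
    rw [← Finset.prod_mul_distrib]
    exact Finset.prod_le_prod' fun i _ => by simpa using h i (s i)
  refine Measure.le_iff.2 fun S hS => ?_
  rw [Measure.smul_apply, smul_eq_mul, ← ENNReal.inv_mul_le_iff hp0 hpt,
    Measure.pi_def ν, toMeasure_apply _ _ hS]
  exact key S

/-! ### The privacy budget -/

lemma plrEps_pos {n : ℕ} {ε lam : ℝ} (hε : 0 < ε) : 0 < plrEps n ε lam := by
  unfold plrEps
  split_ifs with h
  · exact h
  · exact half_pos hε

lemma lam_add_plrDelta_pos {n : ℕ} (hn : 0 < n) {ε lam : ℝ} (hε : 0 < ε) (hlam : 0 < lam) :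
    0 < lam + plrDelta n ε lam := by
  unfold plrDelta
  have hn' : (0 : ℝ) < n := by exact_mod_cast hn
  have he : 0 < Real.exp (ε / 4) - 1 := by
    have := Real.add_one_lt_exp (x := ε / 4) (by positivity)
    linarith
  split_ifs with h
  · simpa using hlam
  · rw [add_sub_cancel]
    positivity

lemma plr_factor_eq {n : ℕ} (hn : 0 < n) {ε lam : ℝ} (hε : 0 < ε) (hlam : 0 < lam) :
    (1 + 1 ^ 2 / (4 * n * (lam + plrDelta n ε lam))) ^ 2 * Real.exp (plrEps n ε lam * 1)
      = Real.exp ε := by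
  have hn' : (0 : ℝ) < n := by exact_mod_cast hn
  have he : 0 < Real.exp (ε / 4) - 1 := by
    have := Real.add_one_lt_exp (x := ε / 4) (by positivity)
    linarith
  unfold plrDelta plrEps
  split_ifs with h
  · have h1 : (1 + 1 ^ 2 / (4 * n * (lam + 0))) ^ 2
        = 1 + 1 / (2 * n * lam) + 1 / (16 * (n : ℝ) ^ 2 * lam ^ 2) := by
      field_simp
      ring
    rw [h1, plrEpsPrime, mul_one, Real.exp_sub, Real.exp_log (by positivity)]
    field_simp
  · have h1 : 1 + 1 ^ 2 / (4 * n * (lam + ((4 * n * (Real.exp (ε / 4) - 1))⁻¹ - lam)))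
        = Real.exp (ε / 4) := by
      rw [add_sub_cancel]
      field_simp
      ring
    rw [h1, ← Real.exp_nat_mul, ← Real.exp_add]
    congr 1
    push_cast
    ring

/-- The law of the output of two stages of which the second uses the output of the first one. -/
lemma map_prod_two_stage_apply {A B V W : Type*} [MeasurableSpace A] [MeasurableSpace B]
    [MeasurableSpace V] [MeasurableSpace W] {μ : Measure A} {ν : Measure B} [SFinite μ] [SFinite ν]
    {L : A → W} (hL : Measurable L) {H : W × B → V} (hH : Measurable H) {S : Set (W × V)}
    (hS : MeasurableSet S) :
    (μ.prod ν).map (fun p => (L p.1, H (L p.1, p.2))) S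
      = ∫⁻ w, ν.map (fun b => H (w, b)) (Prod.mk w ⁻¹' S) ∂μ.map L := by
  have hG : Measurable fun p : W × B => (p.1, H p) := measurable_fst.prodMk hH
  have hcomp : (fun p : A × B => (L p.1, H (L p.1, p.2)))
      = (fun p : W × B => (p.1, H p)) ∘ Prod.map L id := rfl
  rw [hcomp, ← Measure.map_map hG (hL.prodMap measurable_id),
    ← Measure.map_prod_map _ _ hL measurable_id, Measure.map_id, Measure.map_apply hG hS,
    Measure.prod_apply (hG hS)]
  refine lintegral_congr fun w => ?_
  have hsec : Measurable fun b => H (w, b) := hH.comp measurable_prodMk_left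
  rw [Measure.map_apply hsec (measurable_prodMk_left hS)]
  rfl

namespace Config

variable {n d K : ℕ} {C : Config n d K}

lemma lowEps_pos (hε : 0 < C.ε) : 0 < C.lowEps := by
  unfold lowEps
  split_ifs with h
  · exact h
  · exact half_pos hε

lemma exp_sub_one_pos (hε : 0 < C.ε) {k : Fin K} (hq : 0 ≤ C.q k) (hq0 : C.q k ≠ 0) :
    0 < Real.exp (C.ε * C.q k / 4) - 1 := by
  have hq' : 0 < C.q k := lt_of_le_of_ne hq (Ne.symm hq0)
  have := Real.add_one_lt_exp (x := C.ε * C.q k / 4) (by positivity)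
  have : 0 < C.ε * C.q k / 4 := by positivity
  linarith

lemma lam_add_lowDelta_pos (hε : 0 < C.ε) (hlow : C.low.Nonempty) {k : Fin K} (hq : 0 ≤ C.q k)
    (hlam : 0 < C.lam k) : 0 < C.lam k + C.lowDelta k := by
  have hn : (0 : ℝ) < C.low.card := by exact_mod_cast hlow.card_pos
  unfold lowDelta
  split_ifs with h
  · simpa using hlam
  · rw [add_sub_cancel]
    push Not at h
    have := exp_sub_one_pos hε hq h.2
    have := h.2
    positivity

/-- The factor by which the replacement of a sample changes the law of low-level model `k`. -/
def lowFactor (C : Config n d K) (k : Fin K) : ℝ :=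
  (1 + C.q k ^ 2 / (4 * C.low.card * (C.lam k + C.lowDelta k))) ^ 2 * Real.exp (C.lowEps * C.q k)

lemma lowFactor_pos (hε : 0 < C.ε) (hlow : C.low.Nonempty) {k : Fin K} (hq : 0 ≤ C.q k)
    (hlam : 0 < C.lam k) : 0 < C.lowFactor k := by
  have := lam_add_lowDelta_pos hε hlow hq hlam
  unfold lowFactor
  positivity

lemma prod_lowFactor (hε : 0 < C.ε) (hlow : C.low.Nonempty) (hq : ∀ k, 0 ≤ C.q k)
    (hqsum : ∑ k, C.q k = 1) (hlam : ∀ k, 0 < C.lam k) :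
    ∏ k, C.lowFactor k = Real.exp C.ε := by
  have hn : (0 : ℝ) < C.low.card := by exact_mod_cast hlow.card_pos
  by_cases h : 0 < C.epsPrime
  · have hk : ∀ k, C.lowFactor k = Real.exp (Real.log (1 + C.q k ^ 2 / (2 * C.low.card * C.lam k)
        + C.q k ^ 4 / (16 * (C.low.card : ℝ) ^ 2 * C.lam k ^ 2)) + C.epsPrime * C.q k) := by
      intro k
      have hl := hlam k
      rw [Real.exp_add, Real.exp_log (by positivity), lowFactor, lowDelta, lowEps, if_pos h,
        if_pos (Or.inl h)]
      congr 1
      field_simp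
      ring
    rw [Finset.prod_congr rfl fun k _ => hk k, ← Real.exp_sum, Finset.sum_add_distrib,
      ← Finset.mul_sum, hqsum, mul_one, epsPrime, add_sub_cancel]
  · have hk : ∀ k, C.lowFactor k = Real.exp (C.ε * C.q k) := by
      intro k
      rw [lowFactor, lowEps, if_neg h]
      by_cases h0 : C.q k = 0
      · simp [h0]
      · have he := exp_sub_one_pos hε (hq k) h0
        rw [lowDelta, if_neg (by tauto), add_sub_cancel]
        have h1 : 1 + C.q k ^ 2 / (4 * C.low.card
            * (C.q k ^ 2 / (4 * C.low.card * (Real.exp (C.ε * C.q k / 4) - 1))))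
            = Real.exp (C.ε * C.q k / 4) := by
          field_simp
          ring
        rw [h1, ← Real.exp_nat_mul, ← Real.exp_add]
        congr 1
        push_cast
        ring
    rw [Finset.prod_congr rfl fun k _ => hk k, ← Real.exp_sum, ← Finset.mul_sum, hqsum, mul_one]

/-! ### The models of PST-F -/

lemma strongConvexOn_objective {ι E : Type*} [NormedAddCommGroup E] [InnerProductSpace ℝ E]
    (I : Finset ι) (x : ι → E) (y : ι → ℝ) (b : E) {Δ lam : ℝ} {g : E → ℝ} (hlam : 0 ≤ lam)
    (hg : StrongConvexOn Set.univ 1 g) :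
    StrongConvexOn Set.univ (lam + Δ) (objective I x y b Δ lam g) := by
  rw [objective_eq_perturb]
  exact strongConvexOn_perturb (strongConvexOn_riskPart (Nat.cast_nonneg _) _ _ _ hlam hg) _

lemma measurable_lowModel (hε : 0 < C.ε) (hlow : C.low.Nonempty) {k : Fin K} (hq : 0 ≤ C.q k)
    (hlam : 0 < C.lam k) (hg : StrongConvexOn Set.univ 1 (C.g k)) (D : Fin n → Sample d) :
    Measurable fun b => argmin (C.lowObjective D k b) :=
  ((continuous_argmin_objective hlow (fun i => (D i).abs_y_le_one) hlam.le
    (lam_add_lowDelta_pos hε hlow hq hlam) hg).comp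
      (Continuous.prodMk_right fun i => C.scale k (restrict C.block k (D i).x))).measurable

lemma measurable_metaFeatures (x : EuclideanSpace ℝ (Fin d)) :
    Measurable fun w => C.metaFeatures w x := by
  have : Continuous fun w => C.metaFeatures w x := by
    unfold metaFeatures
    have := continuous_sigmoid
    fun_prop
  exact this.measurable

lemma measurable_highModel (hε : 0 < C.ε) (hhigh : C.lowᶜ.Nonempty) (hlam : 0 < C.lamHigh)
    (hg : StrongConvexOn Set.univ 1 C.gHigh) (hs : Measurable C.scaleHigh)
    (D : Fin n → Sample d) :
    Measurable fun p : (∀ k, Block C.block k) × EuclideanSpace ℝ (Fin K) =>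
      argmin (C.highObjective D p.1 p.2) := by
  have hcont := continuous_argmin_objective hhigh (y := fun i => (D i).y)
    (fun i => (D i).abs_y_le_one) hlam.le (lam_add_plrDelta_pos hhigh.card_pos hε hlam) hg
  refine hcont.measurable.comp (f := fun p : (∀ k, Block C.block k) × EuclideanSpace ℝ (Fin K) =>
    ((fun i => C.scaleHigh (C.metaFeatures p.1 (D i).x)), p.2)) (Measurable.prodMk ?_ measurable_snd)
  exact measurable_pi_lambda _ fun i =>
    hs.comp ((measurable_metaFeatures (D i).x).comp measurable_fst)

lemma measurable_lowModels (hε : 0 < C.ε) (hlow : C.low.Nonempty) (hq : ∀ k, 0 ≤ C.q k)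
    (hlam : ∀ k, 0 < C.lam k) (hg : ∀ k, StrongConvexOn Set.univ 1 (C.g k))
    (D : Fin n → Sample d) : Measurable (C.lowModels D) :=
  measurable_pi_lambda _ fun k =>
    (measurable_lowModel hε hlow (hq k) (hlam k) (hg k) D).comp (measurable_pi_apply k)

/-- PST-F trains the high-level model after, and independently of the noise of, the low-level
models. -/
lemma pstf_apply {D : Fin n → Sample d}
    [IsProbabilityMeasure (Measure.pi fun k => noise (Block C.block k) C.lowEps)]
    [IsProbabilityMeasure (noise (EuclideanSpace ℝ (Fin K)) (plrEps C.lowᶜ.card C.ε C.lamHigh))]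
    (hL : Measurable (C.lowModels D))
    (hH : Measurable fun p : (∀ k, Block C.block k) × EuclideanSpace ℝ (Fin K) =>
      argmin (C.highObjective D p.1 p.2))
    {S : Set ((∀ k, Block C.block k) × EuclideanSpace ℝ (Fin K))} (hS : MeasurableSet S) :
    C.pstf D S = ∫⁻ w, (noise (EuclideanSpace ℝ (Fin K)) (plrEps C.lowᶜ.card C.ε C.lamHigh)).map
        (fun b => argmin (C.highObjective D w b)) (Prod.mk w ⁻¹' S)
      ∂(Measure.pi fun k => noise (Block C.block k) C.lowEps).map (C.lowModels D) := by
  exact map_prod_two_stage_apply hL hH hS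

lemma measurable_output {D : Fin n → Sample d} (hL : Measurable (C.lowModels D))
    (hH : Measurable fun p : (∀ k, Block C.block k) × EuclideanSpace ℝ (Fin K) =>
      argmin (C.highObjective D p.1 p.2)) : Measurable (C.output D) := by
  have h : Measurable (Prod.map (C.lowModels D) (id : EuclideanSpace ℝ (Fin K) → _)) :=
    hL.prodMap measurable_id
  have h1 : Measurable fun p : (∀ k, Block C.block k) × EuclideanSpace ℝ (Fin K) =>
      (p.1, argmin (C.highObjective D p.1 p.2)) := measurable_fst.prodMk hH
  exact h1.comp h

lemma objective_congr {ι E : Type*} [NormedAddCommGroup E] [InnerProductSpace ℝ E]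
    {I : Finset ι} {x x' : ι → E} {y y' : ι → ℝ} (hx : ∀ i ∈ I, x i = x' i)
    (hy : ∀ i ∈ I, y i = y' i) (b : E) (Δ lam : ℝ) (g : E → ℝ) :
    objective I x y b Δ lam g = objective I x' y' b Δ lam g := by
  funext w
  unfold objective
  rw [Finset.sum_congr rfl fun i hi => by rw [hx i hi, hy i hi]]

lemma highObjective_congr {D D' : Fin n → Sample d} (h : ∀ i ∈ C.lowᶜ, D i = D' i) :
    C.highObjective D = C.highObjective D' := by
  funext w b
  exact objective_congr (fun i hi => by dsimp only; rw [h i hi]) (fun i hi => by rw [h i hi]) _ _ _ _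

lemma lowModels_congr {D D' : Fin n → Sample d} (h : ∀ i ∈ C.low, D i = D' i) :
    C.lowModels D = C.lowModels D' := by
  funext b k
  exact congrArg argmin
    (objective_congr (fun i hi => by rw [h i hi]) (fun i hi => by rw [h i hi]) _ _ _ _)

/-- Replacing a low-level sample changes the joint law of the low-level models by a factor of at
most `exp ε`. -/
lemma map_lowModels_le (hε : 0 < C.ε) (hlow : C.low.Nonempty) (hq : ∀ k, 0 ≤ C.q k)
    (hqsum : ∑ k, C.q k = 1) (hlam : ∀ k, 0 < C.lam k)
    (hg : ∀ k, StrongConvexOn Set.univ 1 (C.g k)) (hscale : ∀ k, IsScaling (C.q k) (C.scale k))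
    {D D' : Fin n → Sample d} {i : Fin n} (hi : i ∈ C.low) (hD : ∀ j, j ≠ i → D j = D' j) :
    (Measure.pi fun k => noise (Block C.block k) C.lowEps).map (C.lowModels D)
      ≤ ENNReal.ofReal (Real.exp C.ε)
        • (Measure.pi fun k => noise (Block C.block k) C.lowEps).map (C.lowModels D') := by
  have hPlow : ∀ k, IsProbabilityMeasure (noise (Block C.block k) C.lowEps) :=
    fun k => isProbabilityMeasure_noise (lowEps_pos hε)
  have hm := fun D k => measurable_lowModel hε hlow (hq k) (hlam k) (hg k) D
  have hprob : ∀ (D : Fin n → Sample d) k, IsProbabilityMeasure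
      ((noise (Block C.block k) C.lowEps).map fun b => argmin (C.lowObjective D k b)) :=
    fun D k => Measure.isProbabilityMeasure_map (hm D k).aemeasurable
  have hmodel : ∀ D : Fin n → Sample d,
      (Measure.pi fun k => noise (Block C.block k) C.lowEps).map (C.lowModels D)
        = Measure.pi fun k => (noise (Block C.block k) C.lowEps).map
            fun b => argmin (C.lowObjective D k b) :=
    fun D => Measure.pi_map_pi fun k => (hm D k).aemeasurable
  have hk : ∀ k, (noise (Block C.block k) C.lowEps).map (fun b => argmin (C.lowObjective D k b))
      ≤ ENNReal.ofReal (C.lowFactor k) • (noise (Block C.block k) C.lowEps).map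
          fun b => argmin (C.lowObjective D' k b) := fun k =>
    map_noise_argmin_objective_le hi (fun j hj => by rw [hD j hj]) (fun j hj => by rw [hD j hj])
      (hscale k _).2 (hscale k _).2 (D i).abs_y_le_one (D' i).abs_y_le_one
      (lowEps_pos hε).le (hlam k).le (lam_add_lowDelta_pos hε hlow (hq k) (hlam k)) (hg k)
  have hpos := fun k => lowFactor_pos hε hlow (hq k) (hlam k)
  have hle := measure_pi_le_smul_pi
    (fun k => (ENNReal.ofReal_pos.2 (hpos k)).ne') (fun k => ENNReal.ofReal_ne_top) hk
  rw [← ENNReal.ofReal_prod_of_nonneg fun k _ => (hpos k).le,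
    prod_lowFactor hε hlow hq hqsum hlam] at hle
  rwa [hmodel D, hmodel D']

/-- PLR: replacing a high-level sample changes the law of the high-level model by a factor of at
most `exp ε`. -/
lemma map_highModel_le (hε : 0 < C.ε) (hhigh : C.lowᶜ.Nonempty) (hlam : 0 < C.lamHigh)
    (hg : StrongConvexOn Set.univ 1 C.gHigh) (hscale : IsScaling 1 C.scaleHigh)
    {D D' : Fin n → Sample d} {i : Fin n} (hi : i ∈ C.lowᶜ) (hD : ∀ j, j ≠ i → D j = D' j)
    (w : ∀ k, Block C.block k) :
    (noise (EuclideanSpace ℝ (Fin K)) (plrEps C.lowᶜ.card C.ε C.lamHigh)).map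
        (fun b => argmin (C.highObjective D w b))
      ≤ ENNReal.ofReal (Real.exp C.ε)
        • (noise (EuclideanSpace ℝ (Fin K)) (plrEps C.lowᶜ.card C.ε C.lamHigh)).map
          fun b => argmin (C.highObjective D' w b) := by
  have hle := map_noise_argmin_objective_le hi
    (x := fun j => C.scaleHigh (C.metaFeatures w (D j).x))
    (x' := fun j => C.scaleHigh (C.metaFeatures w (D' j).x))
    (y := fun j => (D j).y) (y' := fun j => (D' j).y)
    (fun j hj => by rw [hD j hj]) (fun j hj => by rw [hD j hj])
    (hscale _).2 (hscale _).2 (D i).abs_y_le_one (D' i).abs_y_le_one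
    (plrEps_pos (n := C.lowᶜ.card) (lam := C.lamHigh) hε).le hlam.le
    (lam_add_plrDelta_pos hhigh.card_pos hε hlam) hg
  rw [plr_factor_eq hhigh.card_pos hε hlam] at hle
  exact hle

end Config

end PrivateStacking
end

open MeasureTheory PrivateStacking in
theorem mainTheorem1 {n d K : ℕ} (C : Config n d K)
    (hε : 0 < C.ε)
    (hlow : C.low.Nonempty) (hhigh : C.lowᶜ.Nonempty)
    (hq : ∀ k, 0 ≤ C.q k) (hqsum : ∑ k, C.q k = 1)
    (hlam : ∀ k, 0 < C.lam k) (hlamHigh : 0 < C.lamHigh)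
    (hg : ∀ k, StrongConvexOn Set.univ 1 (C.g k))
    (hgHigh : StrongConvexOn Set.univ 1 C.gHigh)
    (hscale : ∀ k, IsScaling (C.q k) (C.scale k))
    (hscaleHigh : IsScaling 1 C.scaleHigh) (hscaleHigh_meas : Measurable C.scaleHigh) :
    -- the algorithm is well defined: all minimization problems are uniquely solvable
    (∀ D k b, ∃! w, IsMinimizer (C.lowObjective D k b) w) ∧
    (∀ D w b, ∃! v, IsMinimizer (C.highObjective D w b) v) ∧
    -- its output has a law
    (∀ D, IsProbabilityMeasure (C.pstf D)) ∧
    -- and it is differentially private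
    IsDifferentiallyPrivate C.ε C.pstf := by
  have hL := Config.measurable_lowModels hε hlow hq hlam hg
  have hH := Config.measurable_highModel hε hhigh hlamHigh hgHigh hscaleHigh_meas
  have hPlow : ∀ k, IsProbabilityMeasure (noise (Block C.block k) C.lowEps) :=
    fun k => isProbabilityMeasure_noise (Config.lowEps_pos hε)
  have hPhigh : IsProbabilityMeasure
      (noise (EuclideanSpace ℝ (Fin K)) (plrEps C.lowᶜ.card C.ε C.lamHigh)) :=
    isProbabilityMeasure_noise (plrEps_pos hε)
  refine ⟨fun D k b => existsUnique_isMinimizer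
      (Config.strongConvexOn_objective _ _ _ _ (hlam k).le (hg k))
      (Config.lam_add_lowDelta_pos hε hlow (hq k) (hlam k)),
    fun D w b => existsUnique_isMinimizer
      (Config.strongConvexOn_objective _ _ _ _ hlamHigh.le hgHigh)
      (lam_add_plrDelta_pos hhigh.card_pos hε hlamHigh), fun D => ?_, ?_⟩
  · have : IsProbabilityMeasure C.noiseLaw := by unfold Config.noiseLaw; infer_instance
    exact Measure.isProbabilityMeasure_map (Config.measurable_output (hL D) (hH D)).aemeasurable
  rintro D D' ⟨i, hD⟩ S hS
  rw [Config.pstf_apply (hL D) (hH D) hS, Config.pstf_apply (hL D') (hH D') hS]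
  by_cases hi : i ∈ C.low
  · rw [Config.highObjective_congr fun j hj => hD j fun h => Finset.mem_compl.1 hj (h ▸ hi),
      ← smul_eq_mul, ← lintegral_smul_measure]
    exact lintegral_mono' (Config.map_lowModels_le hε hlow hq hqsum hlam hg hscale hi hD) le_rfl
  · rw [Config.lowModels_congr fun j hj => hD j fun h => hi (h ▸ hj),
      ← lintegral_const_mul' _ _ ENNReal.ofReal_ne_top]
    exact lintegral_mono fun w => Config.map_highModel_le hε hhigh hlamHigh hgHigh hscaleHigh
      (Finset.mem_compl.2 hi) hD w _
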